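/- Throughout, $G$ is a countable discrete group and a \emph{representation} $(H_\pi,\pi)$ of $G$ is a homomorphism $\pi$ from $G$ to the unitary group of a separable complex Hilbert space $H_\pi$. \emph{Weak containment.} For representations $\sigma,\pi$ of $G$, write $\sigma\prec\pi$ if for every $\varepsilon>0$, every finite $F\subset G$ and all $v_1,\dots,v_n\in H_\sigma$ there are $w_1,\dots,w_n\in H_\pi$ with $|\langle\sigma(g)v_i,v_j\rangle-\langle\pi(g)w_i,w_j\rangle|<\varepsilon$ for all $g\in F$ and all $i,j\le n$. \emph{Formulas.} Regard $(H_\pi,+,\langle\cdot,\cdot\rangle,\pi)$ as a two-sorted structure, with a sort for the Hilbert space and a sort for the field $\mathbb{C}$. Terms are built from variables of both sorts using $0$, $+$, scalar multiplication and the unary functions $\pi(g)$ ($g\in G$) in the Hilbert space sort, addition, multiplication and constants for the rational numbers in the scalar sort, and the inner product. The atomic formulas are $\langle s,t\rangle\le p$ and $\langle s,t\rangle\ge q$, understood for the real part, the imaginary part or the modulus of $\langle s,t\rangle$, where $s,t$ are terms of the Hilbert space sort and $p,q$ are rational. Quantifier-free formulas are built from atomic ones by conjunction and disjunction. An \emph{approximation}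 of a quantifier-free formula is obtained by relaxing each atomic condition $\langle s,t\rangle\le p$ to $\langle s,t\rangle\le p+\varepsilon$ and each $\langle s,t\rangle\ge q$ to $\langle s,t\rangle\ge q-\varepsilon$, with some rational $\varepsilon>0$ that may depend on the atomic condition. \emph{Existential closedness.} $(H_\pi,+,\langle\cdot,\cdot\rangle,\pi)$ is \emph{existentially closed} if for every representation $(H_\eta,\eta)$ of $G$ extending $(H_\pi,\pi)$, all $v_1,\dots,v_n\in H_\pi$, every quantifier-free formula $\varphi(\bar x,\bar y)$ such that $(H_\eta,+,\langle\cdot,\cdot\rangle,\eta)\models\exists\bar x\,\varphi(\bar x,v_1,\dots,v_n)$, and every approximation $\varphi'$ of $\varphi$, one has $(H_\pi,+,\langle\cdot,\cdot\rangle,\pi)\models\exists\bar x\,\varphi'(\bar x,v_1,\dots,v_n)$. \textbf{Corollary.} Let $G$ be a countable amenable group and let $(H_\pi,\pi)$ be a representation of $G$. Then $(H_\pi,+,\langle\cdot,\cdot\rangle,\pi)$ is existentially closed if and only if $\sigma\prec\pi$ for all representations $(H_\sigma,\sigma)$ of $G$. -/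

import Mathlib

universe u w

/-- A discrete group is amenable if it carries a left-invariant finitely additive probability
measure defined on all of its subsets. -/
def IsAmenableGroup (G : Type w) [Group G] : Prop :=
  ∃ μ : Set G → ℝ,
    (∀ A, 0 ≤ μ A) ∧ μ Set.univ = 1 ∧
    (∀ A B, Disjoint A B → μ (A ∪ B) = μ A + μ B) ∧
    (∀ (g : G) (A : Set G), μ ((fun x => g * x) '' A) = μ A)

/-- A unitary representation of `G` on `H`: a homomorphism from `G` to the group of
surjective linear isometries (unitary operators) of `H`. -/
abbrev UnitaryRep (G : Type w) [Group G] (H : Type u) [NormedAddCommGroup H]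
    [InnerProductSpace ℂ H] : Type (max u w) :=
  G →* (H ≃ₗᵢ[ℂ] H)

section WeakContainment

variable {G : Type w} [Group G]
  {K : Type u} [NormedAddCommGroup K] [InnerProductSpace ℂ K]
  {H : Type u} [NormedAddCommGroup H] [InnerProductSpace ℂ H]

/-- `ρ` is `(ε, F)`-contained in `π`. -/
def UnitaryRep.IsContainedUpTo (ρ : UnitaryRep G K) (π : UnitaryRep G H)
    (ε : ℝ) (F : Finset G) : Prop :=
  ∀ (n : ℕ) (v : Fin n → K), ∃ x : Fin n → H, ∀ g ∈ F, ∀ i j : Fin n,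
    ‖inner ℂ (ρ g (v i)) (v j) - inner ℂ (π g (x i)) (x j)‖ < ε

/-- Weak containment `ρ ≺ π`. -/
def UnitaryRep.IsWeaklyContained (ρ : UnitaryRep G K) (π : UnitaryRep G H) : Prop :=
  ∀ ε : ℝ, 0 < ε → ∀ F : Finset G, ρ.IsContainedUpTo π ε F

end WeakContainment

/-! The two-sorted language `L_G`: a sort for the Hilbert space, with `0`, `+`, the inner product,
and unary functions `π(g)`, and a sort for the field `ℂ`, with its ring operations and constants
for the rational numbers, acting on the Hilbert space sort by scalar multiplication.
`α` indexes the variables of the Hilbert space sort, `β` those of the scalar sort. -/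

mutual

/-- Terms in the sort of the complex field. -/
inductive ScalarTerm (G : Type w) (α β : Type) : Type w
  | var : β → ScalarTerm G α β
  | const : ℚ → ScalarTerm G α β
  | add : ScalarTerm G α β → ScalarTerm G α β → ScalarTerm G α β
  | mul : ScalarTerm G α β → ScalarTerm G α β → ScalarTerm G α β
  | inner : VectorTerm G α β → VectorTerm G α β → ScalarTerm G α β

/-- Terms in the sort of the Hilbert space. -/
inductive VectorTerm (G : Type w) (α β : Type) : Type w
  | var : α → VectorTerm G α β
  | zero : VectorTerm G α β
  | add : VectorTerm G α β → VectorTerm G α β → VectorTerm G α β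
  | smul : ScalarTerm G α β → VectorTerm G α β → VectorTerm G α β
  | act : G → VectorTerm G α β → VectorTerm G α β

end

/-- The real quantities attached to a complex number that atomic formulas may compare with
rational numbers. -/
inductive ComplexPart : Type
  | re
  | im
  | abs

/-- The value of the real part, imaginary part or modulus. -/
noncomputable def ComplexPart.eval : ComplexPart → ℂ → ℝ
  | .re, z => z.re
  | .im, z => z.im
  | .abs, z => ‖z‖

/-- Positive quantifier-free formulas: the atomic formulas are `⟨s, t⟩ ≤ p` and `⟨s, t⟩ ≥ q`
(for the real part, the imaginary part or the modulus of the complex number `⟨s, t⟩`). -/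
inductive QFFormula (G : Type w) (α β : Type) : Type w
  | le : ComplexPart → VectorTerm G α β → VectorTerm G α β → ℚ → QFFormula G α β
  | ge : ComplexPart → VectorTerm G α β → VectorTerm G α β → ℚ → QFFormula G α β
  | and : QFFormula G α β → QFFormula G α β → QFFormula G α β
  | or : QFFormula G α β → QFFormula G α β → QFFormula G α β

/-- `φ.Approx φ'`: the formula `φ'` is an approximation of `φ`, that is, every atomic condition
of `φ` is relaxed by some positive rational number. -/
inductive QFFormula.Approx {G : Type w} {α β : Type} :
    QFFormula G α β → QFFormula G α β → Prop
  | le (c : ComplexPart) (s t : VectorTerm G α β) (p ε : ℚ) (hε : 0 < ε) :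
      QFFormula.Approx (.le c s t p) (.le c s t (p + ε))
  | ge (c : ComplexPart) (s t : VectorTerm G α β) (q ε : ℚ) (hε : 0 < ε) :
      QFFormula.Approx (.ge c s t q) (.ge c s t (q - ε))
  | and {φ φ' ψ ψ' : QFFormula G α β} (hφ : QFFormula.Approx φ φ')
      (hψ : QFFormula.Approx ψ ψ') : QFFormula.Approx (.and φ ψ) (.and φ' ψ')
  | or {φ φ' ψ ψ' : QFFormula G α β} (hφ : QFFormula.Approx φ φ')
      (hψ : QFFormula.Approx ψ ψ') : QFFormula.Approx (.or φ ψ) (.or φ' ψ')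

section Semantics

variable {G : Type w} [Group G]
  {H : Type u} [NormedAddCommGroup H] [InnerProductSpace ℂ H] {α β : Type}

mutual

/-- Value of a scalar term in the structure `(H, +, ⟨·,·⟩, π)`, lifted to the universe of `H`
(which the simultaneous recursion needs). -/
noncomputable def ScalarTerm.evalLift (π : UnitaryRep G H) (x : α → H) (c : β → ℂ) :
    ScalarTerm G α β → ULift.{u} ℂ
  | .var b => ⟨c b⟩
  | .const q => ⟨(q : ℂ)⟩
  | .add a b => ⟨(ScalarTerm.evalLift π x c a).down + (ScalarTerm.evalLift π x c b).down⟩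
  | .mul a b => ⟨(ScalarTerm.evalLift π x c a).down * (ScalarTerm.evalLift π x c b).down⟩
  | .inner s t => ⟨Inner.inner ℂ (VectorTerm.eval π x c s) (VectorTerm.eval π x c t)⟩

/-- Value of a Hilbert space term in the structure `(H, +, ⟨·,·⟩, π)`. -/
noncomputable def VectorTerm.eval (π : UnitaryRep G H) (x : α → H) (c : β → ℂ) :
    VectorTerm G α β → H
  | .var a => x a
  | .zero => 0
  | .add s t => VectorTerm.eval π x c s + VectorTerm.eval π x c t
  | .smul a t => (ScalarTerm.evalLift π x c a).down • VectorTerm.eval π x c t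
  | .act g t => π g (VectorTerm.eval π x c t)

end

/-- Satisfaction of a quantifier-free formula in the structure `(H, +, ⟨·,·⟩, π)`. -/
def QFFormula.Realize (π : UnitaryRep G H) (x : α → H) (c : β → ℂ) : QFFormula G α β → Prop
  | .le d s t p => d.eval (inner ℂ (s.eval π x c) (t.eval π x c)) ≤ (p : ℝ)
  | .ge d s t q => (q : ℝ) ≤ d.eval (inner ℂ (s.eval π x c) (t.eval π x c))
  | .and φ ψ => QFFormula.Realize π x c φ ∧ QFFormula.Realize π x c ψ
  | .or φ ψ => QFFormula.Realize π x c φ ∨ QFFormula.Realize π x c ψ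

/-- `(H, +, ⟨·,·⟩, π) ⊨ ∃ x̄ φ(x̄, v₁, …, vₙ)`, where the tuple `x̄` consists of `m` variables of
the Hilbert space sort and `k` variables of the scalar sort. -/
def QFFormula.ExistsRealize {m n k : ℕ} (π : UnitaryRep G H)
    (φ : QFFormula G (Fin m ⊕ Fin n) (Fin k)) (v : Fin n → H) : Prop :=
  ∃ (x : Fin m → H) (c : Fin k → ℂ), φ.Realize π (Sum.elim x v) c

/-- `(H, +, ⟨·,·⟩, π)` is existentially closed: for every unitary representation `η` on a
separable Hilbert space `K` extending `π` (through an equivariant isometric embedding `ι`), every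
existential formula with parameters from `H` that holds in `η` holds approximately in `π`. -/
def UnitaryRep.IsExistentiallyClosed (π : UnitaryRep G H) : Prop :=
  ∀ (K : Type u) [NormedAddCommGroup K] [InnerProductSpace ℂ K] [CompleteSpace K]
    [TopologicalSpace.SeparableSpace K] (η : UnitaryRep G K) (ι : H →ₗᵢ[ℂ] K),
    (∀ (g : G) (y : H), ι (π g y) = η g (ι y)) →
    ∀ (m n k : ℕ) (v : Fin n → H) (φ : QFFormula G (Fin m ⊕ Fin n) (Fin k)),
      φ.ExistsRealize η (fun i => ι (v i)) →
      ∀ φ' : QFFormula G (Fin m ⊕ Fin n) (Fin k), φ.Approx φ' → φ'.ExistsRealize π v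

end Semantics

-- Every inner product of terms is a polynomial in scalar variables, matrix coefficients of the
-- vector variables and their conjugates, so weak containment and existential closedness both
-- concern approximating coefficients.
--
-- If `π` is existentially closed, any `σ` lies in the extension `π ⊕ σ` of `π`, and finitely many
-- atomic conditions pin its coefficients up to `ε` (`forcedByApprox_inner`).
--
-- Conversely, split a witness in an extension as `w = ι p + r` with `r ⊥ ι H`. It suffices to find
-- `y` in `H` with nearly the coefficients of `r` and nearly orthogonal to prescribed vectors; then
-- `p + y` replaces `w`. Such `y` comes from weak containment of many copies of the extension
-- (`exists_almost_orthogonal_tuple`): by pigeonhole two copies of `r/√2` have nearly equal inner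
-- products with the prescribed vectors, and their difference works.

open Filter Topology

-- Adjoints and direct sums of unitary representations.

section Constructions

variable {G : Type w} [Group G]
  {H : Type u} [NormedAddCommGroup H] [InnerProductSpace ℂ H]
  {K : Type u} [NormedAddCommGroup K] [InnerProductSpace ℂ K]

theorem UnitaryRep.mul_apply (π : UnitaryRep G H) (g h : G) (x : H) :
    π (g * h) x = π g (π h x) := by
  rw [map_mul]
  rfl

theorem UnitaryRep.inner_apply_left (π : UnitaryRep G H) (g : G) (x y : H) :
    inner ℂ (π g x) y = inner ℂ x (π g⁻¹ y) := by
  rw [← (π g⁻¹).inner_map_map, ← π.mul_apply, inv_mul_cancel, map_one]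
  rfl

theorem UnitaryRep.inner_apply_right (π : UnitaryRep G H) (g : G) (x y : H) :
    inner ℂ x (π g y) = inner ℂ (π g⁻¹ x) y := by
  rw [π.inner_apply_left, inv_inv]

/-- The direct sum of `N` copies of a unitary representation. -/
noncomputable def UnitaryRep.copies (ρ : UnitaryRep G K) (N : ℕ) :
    UnitaryRep G (PiLp 2 fun _ : Fin N => K) where
  toFun g := LinearIsometryEquiv.piLpCongrRight 2 fun _ => ρ g
  map_one' := by ext x i; simp
  map_mul' g h := by ext x i; simp

theorem UnitaryRep.inner_copies_single (ρ : UnitaryRep G K) {N : ℕ} (g : G) (k l : Fin N)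
    (x y : K) :
    inner ℂ (ρ.copies N g (PiLp.single 2 k x)) (PiLp.single 2 l y)
      = if k = l then inner ℂ (ρ g x) y else 0 := by
  have h : ρ.copies N g (PiLp.single 2 k x) = PiLp.single 2 k (ρ g x) :=
    LinearIsometryEquiv.piLpCongrRight_single _ _ _
  rw [h, PiLp.inner_apply, Finset.sum_eq_single k]
  · by_cases hkl : k = l
    · subst hkl; simp
    · simp [hkl]
  · intro i _ hi
    simp [hi]
  · simp

/-- The direct sum of two unitary representations. -/
noncomputable def UnitaryRep.directSum (π : UnitaryRep G H) (σ : UnitaryRep G K) :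
    UnitaryRep G (WithLp 2 (H × K)) where
  toFun g :=
    { ((π g).toLinearEquiv.prodCongr (σ g).toLinearEquiv).withLpCongr 2 with
      norm_map' := fun x => by
        rw [← sq_eq_sq₀ (norm_nonneg _) (norm_nonneg _), WithLp.prod_norm_sq_eq_of_L2,
          WithLp.prod_norm_sq_eq_of_L2]
        simp }
  map_one' := by rw [map_one, map_one]; rfl
  map_mul' g h := by rw [map_mul, map_mul]; rfl

theorem UnitaryRep.directSum_toLp (π : UnitaryRep G H) (σ : UnitaryRep G K) (g : G) (x : H)
    (y : K) : π.directSum σ g (WithLp.toLp 2 (x, y)) = WithLp.toLp 2 (π g x, σ g y) := rfl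

/-- The inclusion of the first summand in a Hilbert space direct sum. -/
noncomputable def inlL2 (H K : Type u) [NormedAddCommGroup H] [InnerProductSpace ℂ H]
    [NormedAddCommGroup K] [InnerProductSpace ℂ K] : H →ₗᵢ[ℂ] WithLp 2 (H × K) where
  toFun x := WithLp.toLp 2 (x, 0)
  map_add' x y := by simp [← WithLp.toLp_add]
  map_smul' c x := by simp [← WithLp.toLp_smul]
  norm_map' x := by simp

end Constructions

-- Continuity of formulas in the matrix coefficients.

section Continuity

variable {G : Type w} [Group G]
  {H : Type u} [NormedAddCommGroup H] [InnerProductSpace ℂ H]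
  {K : Type u} [NormedAddCommGroup K] [InnerProductSpace ℂ K]
  {ι : Type*} {l : Filter ι}

/-- The matrix coefficients of the family `s` tend to those of `y` against the tuple `z`. -/
def TendstoCoeff {A : Type} (π : UnitaryRep G H) (η : UnitaryRep G K) (l : Filter ι)
    (z : ι → A → H) (ζ : A → K) (s : ι → H) (y : K) : Prop :=
  ∀ g a, Tendsto (fun n => inner ℂ (π g (s n)) (z n a)) l (𝓝 (inner ℂ (η g y) (ζ a)))

theorem tendsto_inner_swap {π : UnitaryRep G H} {η : UnitaryRep G K} {s t : ι → H} {y y' : K}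
    (h : ∀ g, Tendsto (fun n => inner ℂ (π g (s n)) (t n)) l (𝓝 (inner ℂ (η g y) y'))) (g : G) :
    Tendsto (fun n => inner ℂ (π g (t n)) (s n)) l (𝓝 (inner ℂ (η g y') y)) := by
  have := (Complex.continuous_conj.tendsto _).comp (h g⁻¹)
  simpa [Function.comp_def, inner_conj_symm, π.inner_apply_left g, η.inner_apply_left g]
    using this

mutual

theorem ScalarTerm.tendsto_evalLift {A B : Type} {π : UnitaryRep G H} {η : UnitaryRep G K}
    {z : ι → A → H} {ζ : A → K} (c : B → ℂ)
    (hz : ∀ a, TendstoCoeff π η l z ζ (fun n => z n a) (ζ a)) :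
    ∀ a : ScalarTerm G A B, Tendsto (fun n => (a.evalLift π (z n) c).down) l
      (𝓝 (a.evalLift η ζ c).down)
  | .var b => by
    simp only [ScalarTerm.evalLift]
    exact tendsto_const_nhds
  | .const q => by
    simp only [ScalarTerm.evalLift]
    exact tendsto_const_nhds
  | .add a b => by
    simp only [ScalarTerm.evalLift]
    exact (ScalarTerm.tendsto_evalLift c hz a).add (ScalarTerm.tendsto_evalLift c hz b)
  | .mul a b => by
    simp only [ScalarTerm.evalLift]
    exact (ScalarTerm.tendsto_evalLift c hz a).mul (ScalarTerm.tendsto_evalLift c hz b)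
  | .inner s t => by
    simp only [ScalarTerm.evalLift]
    have h := VectorTerm.tendsto_inner_eval c hz t (fun n => s.eval π (z n) c) (s.eval η ζ c)
      (fun g a => tendsto_inner_swap
        (VectorTerm.tendsto_inner_eval c hz s (fun n => z n a) (ζ a) (hz a)) g) 1
    simpa using h

/-- The values live in different spaces, so only their coefficients can converge. Quantifying over
the test family `s` and over `g` closes the induction: `act` shifts `g`, and for `⟨s, t⟩` the values
of `s` become the test family for `t`, after a swap of arguments. -/
theorem VectorTerm.tendsto_inner_eval {A B : Type} {π : UnitaryRep G H} {η : UnitaryRep G K}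
    {z : ι → A → H} {ζ : A → K} (c : B → ℂ)
    (hz : ∀ a, TendstoCoeff π η l z ζ (fun n => z n a) (ζ a)) :
    ∀ (t : VectorTerm G A B) (s : ι → H) (y : K), TendstoCoeff π η l z ζ s y → ∀ g : G,
      Tendsto (fun n => inner ℂ (π g (s n)) (t.eval π (z n) c)) l
        (𝓝 (inner ℂ (η g y) (t.eval η ζ c)))
  | .var a, s, y, hs, g => by
    simp only [VectorTerm.eval]
    exact hs g a
  | .zero, s, y, hs, g => by
    simp only [VectorTerm.eval, inner_zero_right]
    exact tendsto_const_nhds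
  | .add t t', s, y, hs, g => by
    simp only [VectorTerm.eval, inner_add_right]
    exact (VectorTerm.tendsto_inner_eval c hz t s y hs g).add
      (VectorTerm.tendsto_inner_eval c hz t' s y hs g)
  | .smul a t, s, y, hs, g => by
    simp only [VectorTerm.eval, inner_smul_right]
    exact (ScalarTerm.tendsto_evalLift c hz a).mul
      (VectorTerm.tendsto_inner_eval c hz t s y hs g)
  | .act h t, s, y, hs, g => by
    simp only [VectorTerm.eval]
    simpa only [UnitaryRep.inner_apply_right _ h, ← UnitaryRep.mul_apply]
      using VectorTerm.tendsto_inner_eval c hz t s y hs (h⁻¹ * g)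

end

theorem VectorTerm.tendsto_inner_eval_eval {A B : Type} {π : UnitaryRep G H}
    {η : UnitaryRep G K} {z : ι → A → H} {ζ : A → K} (c : B → ℂ)
    (hz : ∀ a, TendstoCoeff π η l z ζ (fun n => z n a) (ζ a)) (s t : VectorTerm G A B) :
    Tendsto (fun n => inner ℂ (s.eval π (z n) c) (t.eval π (z n) c)) l
      (𝓝 (inner ℂ (s.eval η ζ c) (t.eval η ζ c))) := by
  simpa only [ScalarTerm.evalLift] using ScalarTerm.tendsto_evalLift c hz (.inner s t)

theorem ComplexPart.continuous_eval (d : ComplexPart) : Continuous d.eval := by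
  cases d
  · exact Complex.continuous_re
  · exact Complex.continuous_im
  · exact continuous_norm

/-- Relaxation makes each satisfied atomic inequality strict at the limit, hence an open condition
on the coefficients. -/
theorem QFFormula.Approx.eventually_realize {A B : Type} {π : UnitaryRep G H}
    {η : UnitaryRep G K} {z : ι → A → H} {ζ : A → K} (c : B → ℂ)
    (hz : ∀ a, TendstoCoeff π η l z ζ (fun n => z n a) (ζ a)) {φ φ' : QFFormula G A B}
    (h : φ.Approx φ') (hφ : φ.Realize η ζ c) : ∀ᶠ n in l, φ'.Realize π (z n) c := by
  induction h with
  | le d s t p ε hε =>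
    have hlim := (d.continuous_eval.tendsto _).comp
      (VectorTerm.tendsto_inner_eval_eval c hz s t)
    have hlt : d.eval (inner ℂ (s.eval η ζ c) (t.eval η ζ c)) < ((p + ε : ℚ) : ℝ) :=
      lt_of_le_of_lt hφ (by exact_mod_cast lt_add_of_pos_right p hε)
    filter_upwards [hlim.eventually (gt_mem_nhds hlt)] with n hn using hn.le
  | ge d s t q ε hε =>
    have hlim := (d.continuous_eval.tendsto _).comp
      (VectorTerm.tendsto_inner_eval_eval c hz s t)
    have hlt : ((q - ε : ℚ) : ℝ) < d.eval (inner ℂ (s.eval η ζ c) (t.eval η ζ c)) :=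
      lt_of_lt_of_le (by exact_mod_cast sub_lt_self q hε) hφ
    filter_upwards [hlim.eventually (lt_mem_nhds hlt)] with n hn using hn.le
  | and _ _ ih₁ ih₂ =>
    filter_upwards [ih₁ hφ.1, ih₂ hφ.2] with n h₁ h₂ using ⟨h₁, h₂⟩
  | or _ _ ih₁ ih₂ =>
    rcases hφ with hφ | hφ
    · filter_upwards [ih₁ hφ] with n h₁ using Or.inl h₁
    · filter_upwards [ih₂ hφ] with n h₂ using Or.inr h₂

end Continuity

-- Almost orthogonal copies, and weak containment implies existential closedness.

section Orthogonal

variable {G : Type w} [Group G]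
  {H : Type u} [NormedAddCommGroup H] [InnerProductSpace ℂ H]
  {K : Type u} [NormedAddCommGroup K] [InnerProductSpace ℂ K]

theorem UnitaryRep.IsWeaklyContained.exists_family {ρ : UnitaryRep G K} {π : UnitaryRep G H}
    (h : ρ.IsWeaklyContained π) {ε : ℝ} (hε : 0 < ε) (F : Finset G) {I : Type*} [Fintype I]
    (v : I → K) : ∃ x : I → H, ∀ g ∈ F, ∀ i j,
      ‖inner ℂ (ρ g (v i)) (v j) - inner ℂ (π g (x i)) (x j)‖ < ε := by
  obtain ⟨x, hx⟩ := h ε hε F _ (v ∘ (Fintype.equivFin I).symm)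
  exact ⟨x ∘ Fintype.equivFin I, fun g hg i j => by
    simpa using hx g hg (Fintype.equivFin I i) (Fintype.equivFin I j)⟩

/-- Pigeonhole principle in a bounded subset of a finite-dimensional space. -/
theorem exists_card_forall_exists_ne_dist_lt {E : Type*} [PseudoMetricSpace E] [ProperSpace E]
    (a : E) (R : ℝ) {ε : ℝ} (hε : 0 < ε) :
    ∃ N : ℕ, ∀ f : Fin N → E, (∀ k, f k ∈ Metric.closedBall a R) →
      ∃ k l, k ≠ l ∧ dist (f k) (f l) < ε := by
  obtain ⟨t, -, ht, hcover⟩ := Metric.finite_approx_of_totallyBounded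
    (isCompact_closedBall a R).totallyBounded (ε / 2) (half_pos hε)
  refine ⟨ht.toFinset.card + 1, fun f hf => ?_⟩
  have h : ∀ k, ∃ y ∈ t, f k ∈ Metric.ball y (ε / 2) := fun k => by
    simpa using hcover (hf k)
  choose y hyt hy using h
  obtain ⟨k, -, l, -, hkl, hykl⟩ := Finset.exists_ne_map_eq_of_card_lt_of_maps_to
    (s := Finset.univ) (t := ht.toFinset) (f := y) (by simp) (by intro k _; simpa using hyt k)
  refine ⟨k, l, hkl, ?_⟩
  have h₁ := hy k
  have h₂ := hy l
  rw [Metric.mem_ball] at h₁ h₂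
  rw [← hykl] at h₂
  linarith [dist_triangle_right (f k) (f l) (y k)]

/-- If every finite multiple of `ρ` is weakly contained in `π`, then the matrix coefficients of a
tuple in `ρ` are approximated by those of a tuple in `π` almost orthogonal to a given finite
set. -/
theorem exists_almost_orthogonal_tuple {ρ : UnitaryRep G K} {π : UnitaryRep G H}
    (h : ∀ N, (ρ.copies N).IsWeaklyContained π) {ε : ℝ} (hε : 0 < ε) (F : Finset G)
    (U : Finset H) {I : Type*} [Fintype I] (r : I → K) :
    ∃ y : I → H, (∀ g ∈ F, ∀ i j,
      ‖inner ℂ (ρ g (r i)) (r j) - inner ℂ (π g (y i)) (y j)‖ < ε) ∧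
      ∀ i, ∀ u ∈ U, ‖(inner ℂ (y i) u : ℂ)‖ < ε := by
  classical
  -- With the factor `1/√2`, each of the two copies contributes half of every coefficient.
  set c : ℂ := ((√2 : ℝ) : ℂ)⁻¹ with hc
  have hcc : (starRingEnd ℂ) c * c = 1 / 2 := by
    rw [hc, map_inv₀, Complex.conj_ofReal, ← mul_inv, ← Complex.ofReal_mul,
      Real.mul_self_sqrt (by norm_num)]
    norm_num
  -- A bound, independent of the number of copies, for all inner products with `U`. One `1` is the
  -- error in the squared norm; the other allows passing from the squared norm to the norm.
  set R : ℝ := ∑ i, ∑ u ∈ U, (‖c • r i‖ ^ 2 + 1 + 1) * ‖u‖ with hR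
  have hR₁ : ∀ i, ∀ u ∈ U, (‖c • r i‖ ^ 2 + 1 + 1) * ‖u‖ ≤ R := fun i u hu =>
    (Finset.single_le_sum (f := fun u => (‖c • r i‖ ^ 2 + 1 + 1) * ‖u‖)
      (fun u _ => by positivity) hu).trans
      (Finset.single_le_sum (f := fun i => ∑ u ∈ U, (‖c • r i‖ ^ 2 + 1 + 1) * ‖u‖)
      (fun i _ => by positivity) (Finset.mem_univ i))
  have hR₀ : 0 ≤ R := by positivity
  obtain ⟨N, hN⟩ := exists_card_forall_exists_ne_dist_lt (0 : I × U → ℂ) R hε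
  -- Four errors of `ε / 5` add up below `ε`; the cap `1` and the element `1 : G` serve the norm
  -- bound.
  obtain ⟨x, hx⟩ := (h N).exists_family (lt_min one_pos (by positivity : 0 < ε / 5))
    (insert 1 F) (fun p : Fin N × I => PiLp.single 2 p.1 (c • r p.2))
  simp only [UnitaryRep.inner_copies_single] at hx
  have hnorm : ∀ k i, ‖x (k, i)‖ ≤ ‖c • r i‖ ^ 2 + 1 + 1 := fun k i => by
    have h₁ := (hx 1 (Finset.mem_insert_self _ _) (k, i) (k, i)).trans_le (min_le_left _ _)
    simp only [if_true, map_one, LinearIsometryEquiv.coe_one, id_eq,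
      inner_self_eq_norm_sq_to_K] at h₁
    have h₂ : ‖x (k, i)‖ ^ 2 ≤ ‖c • r i‖ ^ 2 + 1 := by
      have h₃ : ‖((‖c • r i‖ ^ 2 - ‖x (k, i)‖ ^ 2 : ℝ) : ℂ)‖ < 1 := by
        push_cast
        exact h₁
      rw [Complex.norm_real, Real.norm_eq_abs, abs_lt] at h₃
      linarith [h₃.1]
    nlinarith [sq_nonneg (‖x (k, i)‖ - 1)]
  obtain ⟨k, l, hkl, hdist⟩ := hN (fun k p => inner ℂ (x (k, p.1)) (p.2 : H)) (fun k => by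
    rw [mem_closedBall_zero_iff, pi_norm_le_iff_of_nonneg hR₀]
    rintro ⟨i, u, hu⟩
    exact (norm_inner_le_norm _ _).trans
      ((mul_le_mul_of_nonneg_right (hnorm k i) (norm_nonneg _)).trans (hR₁ i u hu)))
  -- The diagonal terms add up to the full coefficient, and the cross terms are small because
  -- distinct copies are orthogonal.
  refine ⟨fun i => x (k, i) - x (l, i), fun g hg i j => ?_, fun i u hu => ?_⟩
  · have hb := fun p q => (hx g (Finset.mem_insert_of_mem hg) p q).trans_le (min_le_right _ _)
    have h₁ := hb (k, i) (k, j)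
    have h₂ := hb (l, i) (l, j)
    have h₃ := hb (k, i) (l, j)
    have h₄ := hb (l, i) (k, j)
    have hhalf : inner ℂ (ρ g (c • r i)) (c • r j) = 1 / 2 * inner ℂ (ρ g (r i)) (r j) := by
      rw [map_smul, inner_smul_left, inner_smul_right, ← mul_assoc, hcc]
    simp only [if_true, hkl, hkl.symm, if_false, hhalf] at h₁ h₂ h₃ h₄
    have hsum : inner ℂ (ρ g (r i)) (r j)
          - inner ℂ (π g (x (k, i) - x (l, i))) (x (k, j) - x (l, j))
        = ((1 / 2 * inner ℂ (ρ g (r i)) (r j) - inner ℂ (π g (x (k, i))) (x (k, j)))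
          + (1 / 2 * inner ℂ (ρ g (r i)) (r j) - inner ℂ (π g (x (l, i))) (x (l, j))))
          - ((0 - inner ℂ (π g (x (k, i))) (x (l, j)))
          + (0 - inner ℂ (π g (x (l, i))) (x (k, j)))) := by
      simp only [map_sub, inner_sub_left, inner_sub_right]
      ring
    rw [hsum]
    refine (norm_sub_le_of_le (norm_add_le_of_le h₁.le h₂.le)
      (norm_add_le_of_le h₃.le h₄.le)).trans_lt ?_
    linarith
  · rw [inner_sub_left, ← dist_eq_norm]
    exact (dist_le_pi_dist (fun p : I × U => inner ℂ (x (k, p.1)) (p.2 : H))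
      (fun p : I × U => inner ℂ (x (l, p.1)) (p.2 : H)) (i, ⟨u, hu⟩)).trans_lt hdist

/-- Indexing by a tolerance and finite subsets of `G` and `H` yields one net that handles every `g`
and every `u` at once. -/
theorem exists_tendsto_orthogonal_tuple {ρ : UnitaryRep G K} {π : UnitaryRep G H}
    (h : ∀ N, (ρ.copies N).IsWeaklyContained π) {I : Type*} [Fintype I] (r : I → K) :
    ∃ y : ℕ × Finset G × Finset H → I → H,
      (∀ g i j, Tendsto (fun n => inner ℂ (π g (y n i)) (y n j)) atTop
        (𝓝 (inner ℂ (ρ g (r i)) (r j)))) ∧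
      ∀ i u, Tendsto (fun n => (inner ℂ (y n i) u : ℂ)) atTop (𝓝 0) := by
  choose y hy hy' using fun n : ℕ × Finset G × Finset H =>
    exists_almost_orthogonal_tuple h (Nat.one_div_pos_of_nat (α := ℝ) (n := n.1)) n.2.1 n.2.2 r
  have hlim : Tendsto (fun n : ℕ × Finset G × Finset H => 1 / ((n.1 : ℝ) + 1)) atTop (𝓝 0) := by
    rw [← prod_atTop_atTop_eq]
    exact tendsto_one_div_add_atTop_nhds_zero_nat.comp tendsto_fst
  refine ⟨y, fun g i j => ?_, fun i u => ?_⟩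
  · refine tendsto_iff_norm_sub_tendsto_zero.2 (squeeze_zero' (.of_forall fun _ => norm_nonneg _)
      ?_ hlim)
    filter_upwards [eventually_ge_atTop (0, {g}, ∅)] with n hn
    rw [norm_sub_rev]
    exact (hy n g (hn.2.1 (Finset.mem_singleton_self g)) i j).le
  · refine tendsto_zero_iff_norm_tendsto_zero.2 (squeeze_zero'
      (.of_forall fun _ => norm_nonneg _) ?_ hlim)
    filter_upwards [eventually_ge_atTop (0, ∅, {u})] with n hn
    exact (hy' n i u (hn.2.2 (Finset.mem_singleton_self u))).le

theorem UnitaryRep.isExistentiallyClosed_of_isWeaklyContained [CompleteSpace H]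
    (π : UnitaryRep G H)
    (h : ∀ (K : Type u) [NormedAddCommGroup K] [InnerProductSpace ℂ K] [CompleteSpace K]
      [TopologicalSpace.SeparableSpace K] (σ : UnitaryRep G K), σ.IsWeaklyContained π) :
    π.IsExistentiallyClosed := by
  classical
  intro K _ _ _ _ η ι hι m n k v φ hφ φ' hφ'
  obtain ⟨w, c, hw⟩ := hφ
  -- As `ι` is isometric, `ι (p i)` is the orthogonal projection of `w i` onto the range of `ι`.
  let p : Fin m → H := fun i => ι.toContinuousLinearMap.adjoint (w i)
  let r : Fin m → K := fun i => w i - ι (p i)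
  have hwr : ∀ i, w i = ι (p i) + r i := fun i => (add_sub_cancel _ _).symm
  have hr : ∀ i y, inner ℂ (r i) (ι y) = 0 := fun i y => by
    have : inner ℂ (p i) y = inner ℂ (w i) (ι y) :=
      ι.toContinuousLinearMap.adjoint_inner_left y (w i)
    rw [inner_sub_left, ι.inner_map_map, this, sub_self]
  have hr' : ∀ i y, inner ℂ (ι y) (r i) = 0 := fun i y => inner_eq_zero_symm.1 (hr i y)
  have := UniformSpace.secondCountable_of_separable K
  obtain ⟨y, hy, hy₀⟩ := exists_tendsto_orthogonal_tuple (fun N => h _ (η.copies N)) r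
  have hy₀' : ∀ i u, Tendsto (fun n => (inner ℂ u (y n i) : ℂ)) atTop (𝓝 0) := fun i u => by
    simpa [Function.comp_def, inner_conj_symm]
      using (Complex.continuous_conj.tendsto _).comp (hy₀ i u)
  -- Cross terms vanish in `η`, since the range of `ι` is invariant and orthogonal to `r`, and tend
  -- to zero in `π`.
  have hz : ∀ a, TendstoCoeff π η atTop (fun n => Sum.elim (p + y n) v)
      (Sum.elim w fun i => ι (v i)) (fun n => Sum.elim (p + y n) v a)
      (Sum.elim w (fun i => ι (v i)) a) := by
    rintro (i | i) g (j | j)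
    · simp only [Sum.elim_inl, Pi.add_apply, hwr, map_add, inner_add_left, inner_add_right, ← hι,
        hr', η.inner_apply_left g (r i) (ι _), hr, ι.inner_map_map, π.inner_apply_left g (y _ i) (p j)]
      exact (tendsto_const_nhds.add (hy₀ _ _)).add ((hy₀' _ _).add (hy _ _ _))
    · simp only [Sum.elim_inl, Sum.elim_inr, Pi.add_apply, hwr, map_add, inner_add_left, ← hι,
        η.inner_apply_left g (r i) (ι _), hr, ι.inner_map_map, π.inner_apply_left g (y _ i) (v j)]
      exact tendsto_const_nhds.add (hy₀ _ _)
    · simp only [Sum.elim_inl, Sum.elim_inr, Pi.add_apply, hwr, inner_add_right, ← hι,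
        hr', ι.inner_map_map]
      exact tendsto_const_nhds.add (hy₀' _ _)
    · simp only [Sum.elim_inr, ← hι, ι.inner_map_map]
      exact tendsto_const_nhds
  obtain ⟨n, hn⟩ := (hφ'.eventually_realize c hz hw).exists
  exact ⟨_, c, hn⟩

end Orthogonal

-- Coefficients pinned by formulas, and existential closedness implies weak containment.

section Definability

variable {G : Type w} [Group G]
  {H : Type u} [NormedAddCommGroup H] [InnerProductSpace ℂ H]
  {K : Type u} [NormedAddCommGroup K] [InnerProductSpace ℂ K] {A B : Type}

/-- Some formula that holds at `w` in `η` has an approximation which forces `S` in `π`. -/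
def ForcedByApprox (π : UnitaryRep G H) (η : UnitaryRep G K) (w : A → K) (c : B → ℂ)
    (S : (A → H) → Prop) : Prop :=
  ∃ φ φ' : QFFormula G A B, φ.Approx φ' ∧ φ.Realize η w c ∧
    ∀ x d, φ'.Realize π x d → S x

variable {π : UnitaryRep G H} {η : UnitaryRep G K} {w : A → K} {c : B → ℂ}
  {S T : (A → H) → Prop}

theorem ForcedByApprox.mono (h : ForcedByApprox π η w c S) (hST : ∀ x, S x → T x) :
    ForcedByApprox π η w c T := by
  obtain ⟨φ, φ', h₁, h₂, h₃⟩ := h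
  exact ⟨φ, φ', h₁, h₂, fun x d hx => hST x (h₃ x d hx)⟩

theorem ForcedByApprox.and (hS : ForcedByApprox π η w c S) (hT : ForcedByApprox π η w c T) :
    ForcedByApprox π η w c fun x => S x ∧ T x := by
  obtain ⟨φ, φ', h₁, h₂, h₃⟩ := hS
  obtain ⟨ψ, ψ', k₁, k₂, k₃⟩ := hT
  exact ⟨.and φ ψ, .and φ' ψ', .and h₁ k₁, ⟨h₂, k₂⟩,
    fun x d hx => ⟨h₃ x d hx.1, k₃ x d hx.2⟩⟩

theorem ForcedByApprox.true : ForcedByApprox π η w c fun _ => True :=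
  -- The language has no constant for truth; `|⟨0, 0⟩| ≤ 0` stands in for it.
  ⟨.le .abs .zero .zero 0, _, .le _ _ _ _ 1 one_pos,
    by simp [QFFormula.Realize, VectorTerm.eval, ComplexPart.eval], fun _ _ _ => trivial⟩

theorem ForcedByApprox.finset_all {J : Type*} {S : J → (A → H) → Prop} (F : Finset J)
    (h : ∀ j ∈ F, ForcedByApprox π η w c (S j)) :
    ForcedByApprox π η w c fun x => ∀ j ∈ F, S j x := by
  classical
  induction F using Finset.induction_on with
  | empty => exact ForcedByApprox.true.mono (by simp)
  | insert a F _ ih =>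
    refine ((h a (Finset.mem_insert_self _ _)).and
      (ih fun j hj => h j (Finset.mem_insert_of_mem hj))).mono fun x hx => ?_
    simpa [Finset.forall_mem_insert] using hx

theorem forcedByApprox_eval_inner (d : ComplexPart) (g : G) (i j : A) {ε : ℝ} (hε : 0 < ε) :
    ForcedByApprox π η w c fun x =>
      |d.eval (inner ℂ (η g (w i)) (w j)) - d.eval (inner ℂ (π g (x i)) (x j))| < ε := by
  set a := d.eval (inner ℂ (η g (w i)) (w j)) with ha
  -- Half of `ε` pays for the rational bounds around `a`, the other half for the relaxation `δ`.
  obtain ⟨δ, hδ, hδε⟩ := exists_rat_btwn (half_pos hε)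
  have hδ₀ : (0 : ℚ) < δ := by exact_mod_cast hδ
  obtain ⟨p, hp, hp'⟩ := exists_rat_btwn (lt_add_of_pos_right a (half_pos hε))
  obtain ⟨q, hq, hq'⟩ := exists_rat_btwn (sub_lt_self a (half_pos hε))
  refine ⟨.and (.le d (.act g (.var i)) (.var j) p) (.ge d (.act g (.var i)) (.var j) q), _,
    .and (.le _ _ _ _ δ hδ₀) (.ge _ _ _ _ δ hδ₀), ?_, fun x e hx => ?_⟩
  · simp only [QFFormula.Realize, VectorTerm.eval]
    exact ⟨hp.le, hq'.le⟩
  · simp only [QFFormula.Realize, VectorTerm.eval, Rat.cast_add, Rat.cast_sub] at hx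
    rw [abs_lt]
    constructor <;> linarith [hx.1, hx.2]

theorem forcedByApprox_inner (g : G) (i j : A) {ε : ℝ} (hε : 0 < ε) :
    ForcedByApprox π η w c fun x =>
      ‖inner ℂ (η g (w i)) (w j) - inner ℂ (π g (x i)) (x j)‖ < ε := by
  refine ((forcedByApprox_eval_inner .re g i j (half_pos hε)).and
    (forcedByApprox_eval_inner .im g i j (half_pos hε))).mono fun x hx => ?_
  refine (Complex.norm_le_abs_re_add_abs_im _).trans_lt ?_
  simp only [ComplexPart.eval] at hx
  rw [Complex.sub_re, Complex.sub_im]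
  linarith [hx.1, hx.2]

theorem UnitaryRep.IsExistentiallyClosed.isWeaklyContained [CompleteSpace H]
    [TopologicalSpace.SeparableSpace H] [CompleteSpace K] [TopologicalSpace.SeparableSpace K]
    (h : π.IsExistentiallyClosed) (σ : UnitaryRep G K) : σ.IsWeaklyContained π := by
  intro ε hε F n v
  have := UniformSpace.secondCountable_of_separable H
  have := UniformSpace.secondCountable_of_separable K
  obtain ⟨φ, φ', h₁, h₂, h₃⟩ : ForcedByApprox π (π.directSum σ)
      (Sum.elim (fun i => WithLp.toLp 2 (0, v i)) Fin.elim0 : Fin n ⊕ Fin 0 → _)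
      (Fin.elim0 : Fin 0 → ℂ) _ :=
    ForcedByApprox.finset_all (F ×ˢ (Finset.univ : Finset (Fin n × Fin n))) fun p _ =>
      forcedByApprox_inner p.1 (Sum.inl p.2.1) (Sum.inl p.2.2) hε
  -- The formula needs neither parameters from `H` nor scalar variables, hence the two zeros.
  obtain ⟨x, d, hx⟩ := h (WithLp 2 (H × K)) (π.directSum σ) (inlL2 H K)
    (fun g y => by simp [inlL2, UnitaryRep.directSum_toLp]) n 0 0 Fin.elim0 φ
    ⟨_, _, by convert h₂ using 2⟩ φ' h₁
  refine ⟨x, fun g hg i j => ?_⟩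
  simpa [UnitaryRep.directSum_toLp, WithLp.prod_inner_apply] using h₃ _ _ hx (g, i, j) (by simpa using hg)

end Definability

theorem mainTheorem5 {G : Type w} [Group G] [Countable G] (hG : IsAmenableGroup G)
    {H : Type u} [NormedAddCommGroup H] [InnerProductSpace ℂ H] [CompleteSpace H]
    [TopologicalSpace.SeparableSpace H] (π : UnitaryRep G H) :
    π.IsExistentiallyClosed ↔
      ∀ (K : Type u) [NormedAddCommGroup K] [InnerProductSpace ℂ K] [CompleteSpace K]
        [TopologicalSpace.SeparableSpace K] (σ : UnitaryRep G K), σ.IsWeaklyContained π :=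
  ⟨fun h _ _ _ _ _ σ => h.isWeaklyContained σ,
    π.isExistentiallyClosed_of_isWeaklyContained⟩
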